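/- Let $X=(X_n)_{n\in\mathbb Z}$ be i.i.d. random variables with values in $\{-1,0,1,2,\dots\}$ such that $\mathbb P[X_0=-1]>0$, $X_0$ is integrable and $\mathbb E[X_0]=0$. For a sequence $x=(x_n)_{n\in\mathbb Z}$ of integers, the record map $R_x:\mathbb Z\to\mathbb Z$ sends $i$ to the least $j>i$ with $\sum_{k=i}^{j-1}x_k\ge 0$, and to $i$ if there is no such $j$. The $R$-foil of $i$ is the set of all $k\in\mathbb Z$ with $R_x^n(k)=R_x^n(i)$ for some $n\ge 0$. The map $R_\perp$ sends $i$ to the least element of the $R$-foil of $i$ that is larger than $i$, and to $i$ if there is no such element. Let $[\mathbb Z,i,x]$ denote the class, up to root- and mark-preserving isomorphism, of the network with vertex set $\mathbb Z$, root $i$, and directed edges $(n,n+1)$ with marks $x_n$, $n\in\mathbb Z$. The space of such classes of connected, locally finite rooted networks carries the Borel $\sigma$-algebra of the local topology. Then, for the maps $R_X$ and $R_\perp$ associated with $X$: 1. almost surely, no $R$-foil has a largest element; 2. almost surely, $R_\perp:\mathbb Z\to\mathbb Z$ is bijective; 3. $R_\perp$ preserves the distribution of $X$: $[\mathbb Z,R_\perp(0),X]$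 has the same distribution as $[\mathbb Z,0,X]$, and the sequence $(X_{n+R_\perp(0)})_{n\in\mathbb Z}$ has the same distribution as $(X_n)_{n\in\mathbb Z}$. -/

import Mathlib

open MeasureTheory ProbabilityTheory

namespace RecordFoil

/-! ### Rooted marked networks and the local topology -/

/-- A rooted network with (discrete) mark space `Ξ`: a connected, locally finite graph with a root,
a mark for every vertex, and for every edge two marks, one for each of its endpoints.
`edgeMark u v` is the mark that the edge `{u, v}` carries at its endpoint `u`;
its value is irrelevant when `u` and `v` are not adjacent.
(A connected locally finite graph is countable, so vertex sets in `Type` suffice.) -/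
structure RootedNetwork (Ξ : Type) where
  V : Type
  graph : SimpleGraph V
  connected : graph.Connected
  locallyFinite : ∀ v, (graph.neighborSet v).Finite
  vertexMark : V → Ξ
  edgeMark : V → V → Ξ
  root : V

namespace RootedNetwork

variable {Ξ : Type}

/-- Existence of a rooted isomorphism: a graph isomorphism that preserves the root and all marks. -/
def Equivalent (N M : RootedNetwork Ξ) : Prop :=
  ∃ φ : N.graph ≃g M.graph, φ N.root = M.root ∧
    (∀ u, M.vertexMark (φ u) = N.vertexMark u) ∧
    ∀ u v, N.graph.Adj u v → M.edgeMark (φ u) (φ v) = N.edgeMark u v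

theorem equivalent_equivalence : Equivalence (Equivalent (Ξ := Ξ)) where
  refl N := ⟨SimpleGraph.Iso.refl, rfl, fun _ => rfl, fun _ _ _ => rfl⟩
  symm := by
    rintro N M ⟨φ, hr, hv, he⟩
    refine ⟨φ.symm, ?_, fun u => ?_, fun u v huv => ?_⟩
    · rw [← hr]; exact φ.symm_apply_apply _
    · have h := hv (φ.symm u)
      rw [φ.apply_symm_apply] at h
      exact h.symm
    · have h := he (φ.symm u) (φ.symm v) (φ.symm.map_adj_iff.2 huv)
      rw [φ.apply_symm_apply, φ.apply_symm_apply] at h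
      exact h.symm
  trans := by
    rintro N M K ⟨φ, hr, hv, he⟩ ⟨ψ, hr', hv', he'⟩
    refine ⟨φ.trans ψ, ?_, fun u => ?_, fun u v huv => ?_⟩
    · exact (congrArg ψ hr).trans hr'
    · exact (hv' (φ u)).trans (hv u)
    · exact (he' (φ u) (φ v) (φ.map_adj_iff.2 huv)).trans (he u v huv)

/-- Rooted isomorphism as a setoid. -/
def setoid (Ξ : Type) : Setoid (RootedNetwork Ξ) := ⟨Equivalent, equivalent_equivalence⟩

/-- The vertices at graph distance at most `r` from the root. -/
def ball (N : RootedNetwork Ξ) (r : ℕ) : Set N.V := {v | N.graph.dist N.root v ≤ r}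

theorem root_mem_ball (N : RootedNetwork Ξ) (r : ℕ) : N.root ∈ N.ball r := by
  simp [ball]

/-- The neighbourhoods of radius `r` of the two roots (induced subgraphs, with induced marks)
are isomorphic as rooted networks. -/
def SameBall (r : ℕ) (N M : RootedNetwork Ξ) : Prop :=
  ∃ φ : N.graph.induce (N.ball r) ≃g M.graph.induce (M.ball r),
    φ ⟨N.root, N.root_mem_ball r⟩ = ⟨M.root, M.root_mem_ball r⟩ ∧
    (∀ u, M.vertexMark (φ u) = N.vertexMark u) ∧
    ∀ u v : N.ball r, N.graph.Adj u v → M.edgeMark (φ u) (φ v) = N.edgeMark u v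

end RootedNetwork

/-- The space of rooted networks up to rooted isomorphism. -/
def NetworkSpace (Ξ : Type) : Type 1 := Quotient (RootedNetwork.setoid Ξ)

namespace NetworkSpace

variable {Ξ : Type}

/-- The equivalence class of a rooted network. -/
def mk (N : RootedNetwork Ξ) : NetworkSpace Ξ := Quotient.mk (RootedNetwork.setoid Ξ) N

/-- The local topology, for a discrete mark space: it is generated by the sets of all classes of
networks that have a prescribed neighbourhood of some finite radius around the root. -/
instance : TopologicalSpace (NetworkSpace Ξ) :=
  TopologicalSpace.generateFrom
    {U | ∃ (r : ℕ) (N : RootedNetwork Ξ), U = {q | ∃ M, q = mk M ∧ N.SameBall r M}}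

instance : MeasurableSpace (NetworkSpace Ξ) := borel (NetworkSpace Ξ)

instance : BorelSpace (NetworkSpace Ξ) := ⟨rfl⟩

end NetworkSpace

/-! ### The network associated to an integer sequence -/

/-- The line graph on `ℤ`: the edges are `{n, n + 1}`. -/
def lineGraph : SimpleGraph ℤ where
  Adj m n := n = m + 1 ∨ m = n + 1
  symm := ⟨fun _ _ h => h.symm⟩
  loopless := ⟨fun m h => by omega⟩

theorem lineGraph_connected : lineGraph.Connected := by
  have step : ∀ n : ℤ, lineGraph.Reachable n (n + 1) := fun n =>
    SimpleGraph.Adj.reachable (Or.inl rfl)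
  have up : ∀ (k : ℕ) (n : ℤ), lineGraph.Reachable n (n + k) := by
    intro k n
    induction k with
    | zero => simp
    | succ k ih =>
      have h := ih.trans (step (n + k))
      rwa [show n + (k : ℤ) + 1 = n + ((k + 1 : ℕ) : ℤ) by push_cast; ring] at h
  have pre : lineGraph.Preconnected := by
    intro a b
    rcases le_total a b with h | h
    · have h1 := up (b - a).toNat a
      rwa [show a + ((b - a).toNat : ℤ) = b by omega] at h1
    · have h1 := up (a - b).toNat b
      rw [show b + ((a - b).toNat : ℤ) = a by omega] at h1
      exact h1.symm
  exact ⟨pre⟩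

theorem lineGraph_locallyFinite (n : ℤ) : (lineGraph.neighborSet n).Finite := by
  refine Set.Finite.subset (Set.finite_Icc (n - 1) (n + 1)) ?_
  rintro m (h | h) <;> simp only [Set.mem_Icc] <;> omega

/-- The network `(ℤ, x)` rooted at `i`: the directed edge `(n, n + 1)` has label `x n`.
The direction is encoded by the second component of the two marks of an edge:
`false` at the tail `n` and `true` at the head `n + 1`. Vertices carry a constant mark. -/
def seqNetwork (i : ℤ) (x : ℤ → ℤ) : RootedNetwork (ℤ × Bool) where
  V := ℤ
  graph := lineGraph
  connected := lineGraph_connected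
  locallyFinite := lineGraph_locallyFinite
  vertexMark _ := (0, false)
  edgeMark u v := if v = u + 1 then (x u, false) else (x v, true)
  root := i

/-- The class `[ℤ, i, x]`. -/
def network (i : ℤ) (x : ℤ → ℤ) : NetworkSpace (ℤ × Bool) := NetworkSpace.mk (seqNetwork i x)

/-! ### The record map, its foils, and the orthogonal map -/

/-- `partialSum x n j = x n + ⋯ + x (j - 1)` for `n ≤ j`. -/
noncomputable def partialSum (x : ℤ → ℤ) (n j : ℤ) : ℤ := ∑ l ∈ Finset.Ico n j, x l

open Classical in
/-- The record map: the least `j > n` with `x n + ⋯ + x (j - 1) ≥ 0`, or `n` if there is none. -/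
noncomputable def recordMap (x : ℤ → ℤ) (n : ℤ) : ℤ :=
  if {j : ℤ | n < j ∧ 0 ≤ partialSum x n j}.Nonempty then
    sInf {j : ℤ | n < j ∧ 0 ≤ partialSum x n j}
  else n

/-- The foil of `u`: all `v` that some iterate of the record map sends to the same place as `u`. -/
def foil (x : ℤ → ℤ) (u : ℤ) : Set ℤ := {v | ∃ n : ℕ, (recordMap x)^[n] u = (recordMap x)^[n] v}

open Classical in
/-- The orthogonal map: the least element of the foil of `u` larger than `u`,
or `u` if there is none. -/
noncomputable def orthogonalMap (x : ℤ → ℤ) (u : ℤ) : ℤ :=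
  if {k : ℤ | u < k ∧ k ∈ foil x u}.Nonempty then
    sInf {k : ℤ | u < k ∧ k ∈ foil x u}
  else u

/-- I.i.d. increments of a skip-free to the left random walk. -/
structure IsSkipFreeIncrements {Ω : Type*} [MeasurableSpace Ω] (P : Measure Ω)
    (X : ℤ → Ω → ℤ) : Prop where
  measurable : ∀ n, Measurable (X n)
  indep : iIndepFun X P
  identDistrib : ∀ n, IdentDistrib (X n) (X 0) P P
  neg_one_le : ∀ n, ∀ᵐ ω ∂P, -1 ≤ X n ω
  neg_one_pos : 0 < P {ω | X 0 ω = -1}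
  integrable : Integrable (fun ω => (X 0 ω : ℝ)) P

end RecordFoil

namespace RecordFoil

/-! ### The first element beyond a point -/

/-! Write $S$ for the walk with increments $x$; then $R(i)$ is the first $j>i$ with $S_j\ge S_i$.
The proof combines the geometry of this map with mass transport: for a shift-invariant rule, the
expected mass sent by $0$ equals the expected mass it receives (`tsum_measure_transport`).

Read backwards, $S$ has centred steps at most $1$, so a stopped martingale bounded above shows that
every vertex has an earlier, strictly higher one (`ae_exists_walk_lt`). Downward steps have size at
most one, so $j$ then has at least $x_{j-1}+1$ children (`exists_children`). This number has mean
$1$, and each vertex sends at most one unit to its image. Transport therefore forces $R(i)>i$ for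
all $i$ almost surely (`ae_lt_recordMap`).

The record graph is now a tree. A finite foil would have only finitely many descendants, hence a
last generation below it, whose largest vertex is unique for the whole of $\mathbb Z$. No stationary
sequence can single out one vertex, so all foils are infinite (`ae_infinite_foil`). A largest or a
least element would receive mass from its whole infinite foil, so neither exists (`ae_no_greatest`,
`ae_no_least`). On each foil $R_\perp$ is thus the successor map of a set unbounded on both sides, a
bijection.

A last transport along $R_\perp$ gives the invariance of the law of the sequence. Networks follow
because rerooting is shifting and the network depends continuously on the sequence. -/

open Classical in
theorem ite_sInf_eq_iff {A : Set ℤ} {i j : ℤ} (hA : ∀ k ∈ A, i < k) :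
    (if A.Nonempty then sInf A else i) = j ↔ IsLeast A j ∨ (A = ∅ ∧ j = i) := by
  have hbdd : BddBelow A := ⟨i, fun k hk => (hA k hk).le⟩
  split_ifs with h
  · have hs : IsLeast A (sInf A) := ⟨Int.csInf_mem h hbdd, fun k hk => csInf_le hbdd hk⟩
    constructor
    · rintro rfl
      exact Or.inl hs
    · rintro (hj | ⟨he, -⟩)
      · exact hs.unique hj
      · exact absurd he h.ne_empty
  · rw [Set.not_nonempty_iff_eq_empty] at h
    subst h
    constructor
    · rintro rfl
      exact Or.inr ⟨rfl, rfl⟩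
    · rintro (hj | ⟨-, rfl⟩)
      · exact absurd hj.1 (Set.notMem_empty _)
      · rfl

/-! ### The walk with given increments -/

theorem partialSum_add_one (x : ℤ → ℤ) {a b : ℤ} (h : a ≤ b) :
    partialSum x a (b + 1) = partialSum x a b + x b := by
  have : Finset.Ico a (b + 1) = insert b (Finset.Ico a b) := by
    ext k; simp only [Finset.mem_insert, Finset.mem_Ico]; omega
  rw [partialSum, this, Finset.sum_insert (by simp), add_comm, partialSum]

theorem partialSum_eq_add (x : ℤ → ℤ) {a b : ℤ} (h : a < b) :
    partialSum x a b = x a + partialSum x (a + 1) b := by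
  have : Finset.Ico a b = insert a (Finset.Ico (a + 1) b) := by
    ext k; simp only [Finset.mem_insert, Finset.mem_Ico]; omega
  rw [partialSum, this, Finset.sum_insert (by simp), partialSum]

theorem partialSum_of_le (x : ℤ → ℤ) {a b : ℤ} (h : b ≤ a) : partialSum x a b = 0 := by
  rw [partialSum, Finset.Ico_eq_empty (by omega), Finset.sum_empty]

/-- The walk with increments `x` that vanishes at `0`. -/
noncomputable def walk (x : ℤ → ℤ) (n : ℤ) : ℤ := partialSum x 0 n - partialSum x n 0

theorem walk_add_one (x : ℤ → ℤ) (n : ℤ) : walk x (n + 1) = walk x n + x n := by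
  rcases le_or_gt 0 n with h | h
  · rw [walk, walk, partialSum_add_one x h, partialSum_of_le x (a := n + 1) (by omega),
      partialSum_of_le x h]
    ring
  · rw [walk, walk, partialSum_eq_add x h, partialSum_of_le x (b := n + 1) (by omega),
      partialSum_of_le x h.le]
    ring

theorem partialSum_eq_walk_sub (x : ℤ → ℤ) {a b : ℤ} (h : a ≤ b) :
    partialSum x a b = walk x b - walk x a := by
  induction b, h using Int.leInduction with
  | base => rw [partialSum_of_le x le_rfl, sub_self]
  | succ b h ih => rw [partialSum_add_one x h, ih, walk_add_one]; ring

/-! ### The record map in terms of the walk -/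

/-- Eliminates the infimum: only comparisons of walk values remain, which makes shift equivariance
and measurability direct. The second alternative is the default value at a vertex without a later
record. -/
theorem recordMap_eq_iff {x : ℤ → ℤ} {i j : ℤ} : recordMap x i = j ↔
    (i < j ∧ walk x i ≤ walk x j ∧ ∀ k, i < k → k < j → walk x k < walk x i) ∨
      ((∀ k, i < k → walk x k < walk x i) ∧ j = i) := by
  rw [recordMap, ite_sInf_eq_iff fun k hk => hk.1]
  refine or_congr ?_ (and_congr_left fun _ => ?_)
  · constructor
    · rintro ⟨⟨h, h0⟩, hk⟩
      rw [partialSum_eq_walk_sub x h.le] at h0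
      refine ⟨h, by omega, fun k hik hkj => ?_⟩
      by_contra hc
      have := hk (show k ∈ {j : ℤ | i < j ∧ 0 ≤ partialSum x i j} from
        ⟨hik, by rw [partialSum_eq_walk_sub x hik.le]; omega⟩)
      omega
    · rintro ⟨h, h0, hk⟩
      refine ⟨⟨h, by rw [partialSum_eq_walk_sub x h.le]; omega⟩, ?_⟩
      rintro k ⟨hik, h1⟩
      rw [partialSum_eq_walk_sub x hik.le] at h1
      by_contra hc
      have := hk k hik (by omega)
      omega
  · rw [Set.eq_empty_iff_forall_notMem]
    refine forall_congr' fun k => ?_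
    simp only [Set.mem_ofPred_eq, not_and, not_le]
    refine forall_congr' fun h => ?_
    rw [partialSum_eq_walk_sub x h.le]
    omega

theorem walk_le_walk_recordMap (x : ℤ → ℤ) (i : ℤ) : walk x i ≤ walk x (recordMap x i) := by
  rcases recordMap_eq_iff.1 (rfl : recordMap x i = _) with h | h
  · exact h.2.1
  · rw [h.2]

theorem walk_lt_of_lt_recordMap {x : ℤ → ℤ} {i k : ℤ} (h : i < k) (hk : k < recordMap x i) :
    walk x k < walk x i := by
  rcases recordMap_eq_iff.1 (rfl : recordMap x i = _) with h' | h'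
  · exact h'.2.2 k h hk
  · omega

theorem recordMap_le {x : ℤ → ℤ} {i k : ℤ} (h : i < k) (hk : walk x i ≤ walk x k) :
    recordMap x i ≤ k := by
  by_contra! hc
  exact absurd (walk_lt_of_lt_recordMap h hc) (not_lt.2 hk)

/-! ### Foils -/

theorem mem_foil_self (x : ℤ → ℤ) (i : ℤ) : i ∈ foil x i := ⟨0, rfl⟩

theorem mem_foil_symm {x : ℤ → ℤ} {i j : ℤ} (h : j ∈ foil x i) : i ∈ foil x j := by
  obtain ⟨n, hn⟩ := h
  exact ⟨n, hn.symm⟩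

theorem mem_foil_trans {x : ℤ → ℤ} {i j k : ℤ} (h : j ∈ foil x i) (h' : k ∈ foil x j) :
    k ∈ foil x i := by
  obtain ⟨n, hn⟩ := h
  obtain ⟨m, hm⟩ := h'
  refine ⟨m + n, ?_⟩
  rw [Function.iterate_add_apply, hn, ← Function.iterate_add_apply, add_comm,
    Function.iterate_add_apply, hm, ← Function.iterate_add_apply, add_comm]

theorem foil_eq_of_mem {x : ℤ → ℤ} {i j : ℤ} (h : j ∈ foil x i) : foil x j = foil x i :=
  Set.Subset.antisymm (fun _ hk => mem_foil_trans h hk)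
    fun _ hk => mem_foil_trans (mem_foil_symm h) hk

theorem iterate_mem_foil {x : ℤ → ℤ} {i j : ℤ} (h : j ∈ foil x i) (n : ℕ) :
    (recordMap x)^[n] j ∈ foil x ((recordMap x)^[n] i) := by
  obtain ⟨m, hm⟩ := h
  exact ⟨m, by rw [← Function.iterate_add_apply, ← Function.iterate_add_apply, add_comm,
    Function.iterate_add_apply, Function.iterate_add_apply, hm]⟩

/-! ### The record graph of an oscillating walk -/

section Deterministic

variable {x : ℤ → ℤ}

/-- Arcs of the record graph do not cross: strictly between $i$ and $R(i)$ the walk is below $S_i\le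
S_{R(i)}$, so records started there cannot jump past $R(i)$. -/
theorem exists_iterate_eq_recordMap (hR : ∀ i, i < recordMap x i) {i j : ℤ} (hij : i < j)
    (hj : j ≤ recordMap x i) : ∃ m, (recordMap x)^[m] j = recordMap x i := by
  obtain ⟨d, hd⟩ : ∃ d : ℕ, (recordMap x i - j).toNat = d := ⟨_, rfl⟩
  induction d using Nat.strong_induction_on generalizing j with
  | _ d ih =>
    rcases hj.eq_or_lt with rfl | hlt
    · exact ⟨0, rfl⟩
    · have h1 := walk_lt_of_lt_recordMap hij hlt
      have h2 := walk_le_walk_recordMap x i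
      have h3 := recordMap_le (x := x) hlt (by omega)
      have h4 := hR j
      obtain ⟨m, hm⟩ := ih (recordMap x i - recordMap x j).toNat (by omega) (by omega) h3 rfl
      exact ⟨m + 1, hm⟩

theorem exists_iterate_eq_iterate_of_lt (hR : ∀ i, i < recordMap x i) {i j : ℤ} (hij : i < j) :
    ∃ n m, (recordMap x)^[n] i = (recordMap x)^[m] j := by
  obtain ⟨d, hd⟩ : ∃ d : ℕ, (j - i).toNat = d := ⟨_, rfl⟩
  induction d using Nat.strong_induction_on generalizing i with
  | _ d ih =>
    rcases le_or_gt j (recordMap x i) with h | h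
    · obtain ⟨m, hm⟩ := exists_iterate_eq_recordMap hR hij h
      exact ⟨1, m, hm.symm⟩
    · have := hR i
      obtain ⟨n, m, h⟩ := ih (j - recordMap x i).toNat (by omega) h rfl
      exact ⟨n + 1, m, h⟩

theorem exists_iterate_eq_iterate (hR : ∀ i, i < recordMap x i) (i j : ℤ) :
    ∃ n m, (recordMap x)^[n] i = (recordMap x)^[m] j := by
  rcases lt_trichotomy i j with h | rfl | h
  · exact exists_iterate_eq_iterate_of_lt hR h
  · exact ⟨0, 0, rfl⟩
  · obtain ⟨n, m, h⟩ := exists_iterate_eq_iterate_of_lt hR h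
    exact ⟨m, n, h.symm⟩

theorem add_le_iterate (hR : ∀ i, i < recordMap x i) (i : ℤ) (n : ℕ) :
    i + n ≤ (recordMap x)^[n] i := by
  induction n with
  | zero => simp
  | succ n ih =>
    rw [Function.iterate_succ_apply']
    have := hR ((recordMap x)^[n] i)
    push_cast
    omega

/-- A higher vertex $i<j$ shields $j$ from everything at or before $i$: an orbit that lands on or
jumps over $i$ has height at least $S_i$ from then on. This bounds the descendants of $j$ on the
left. -/
theorem lt_of_iterate_eq {i j k : ℤ} (hij : walk x j < walk x i) (hlt : i < j) {n : ℕ}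
    (h : (recordMap x)^[n] k = j) : i < k := by
  by_contra! hk
  have key : ∀ n : ℕ, (recordMap x)^[n] k ≤ i ∨ walk x i ≤ walk x ((recordMap x)^[n] k) := by
    intro n
    induction n with
    | zero => exact Or.inl hk
    | succ n ih =>
      rw [Function.iterate_succ_apply']
      set l := (recordMap x)^[n] k
      have h1 := walk_le_walk_recordMap x l
      rcases ih with ih | ih
      · by_cases hc : recordMap x l ≤ i
        · exact Or.inl hc
        · rcases ih.eq_or_lt with he | hl
          · right; rwa [← he]
          · have := walk_lt_of_lt_recordMap (x := x) hl (by omega)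
            right; omega
      · right; omega
  rcases key n with h' | h' <;> rw [h] at h' <;> omega

/-- The largest vertex of a finite generation none of whose members has children. -/
def IsYoungest (x : ℤ → ℤ) (k : ℤ) : Prop :=
  IsGreatest (foil x k) k ∧ ∀ l ∈ foil x k, ∀ i, recordMap x i ≠ l

/-- Two orbits meet, after $n$ and $m$ steps say. If $n\ne m$, one of the two childless generations
would contain a proper iterate, which has a child; hence $n=m$ and the foils coincide. -/
theorem IsYoungest.unique (hR : ∀ i, i < recordMap x i) {k k' : ℤ} (hk : IsYoungest x k)
    (hk' : IsYoungest x k') : k = k' := by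
  obtain ⟨n, m, h⟩ := exists_iterate_eq_iterate hR k k'
  have aux : ∀ {k k' : ℤ}, IsYoungest x k → ∀ {n m : ℕ}, n ≤ m →
      (recordMap x)^[n] k = (recordMap x)^[m] k' → n = m := by
    intro k k' hk n m hnm h
    obtain ⟨d, rfl⟩ := Nat.exists_eq_add_of_le hnm
    rw [Function.iterate_add_apply] at h
    cases d with
    | zero => rfl
    | succ d =>
      exact absurd (Function.iterate_succ_apply' (recordMap x) d k').symm
        (hk.2 _ ⟨n, h⟩ _)
  have hnm : n = m := by
    rcases le_total n m with hle | hle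
    · exact aux hk hle h
    · exact (aux hk' hle h.symm).symm
  subst hnm
  have hmem : k' ∈ foil x k := ⟨n, h⟩
  have h' := hk'.1
  rw [foil_eq_of_mem hmem] at h'
  exact hk.1.unique h'

/-- All descendants of a finite foil lie in a bounded window, and each generation moves by at least
one, so only finitely many generations below it are nonempty. The last one contains the required
vertex. -/
theorem exists_isYoungest (hR : ∀ i, i < recordMap x i)
    (hB : ∀ j, ∃ i < j, walk x j < walk x i) {i : ℤ} (hfin : (foil x i).Finite) :
    ∃ k, IsYoungest x k := by
  choose b hb hwb using hB
  let D : Set ℤ := ⋃ j ∈ foil x i, Set.Icc (b j) j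
  have hD : D.Finite := hfin.biUnion fun j _ => Set.finite_Icc _ _
  have hsub : ∀ k n, (recordMap x)^[n] k ∈ foil x i → k ∈ D := by
    intro k n h
    refine Set.mem_biUnion h ⟨(lt_of_iterate_eq (hwb _) (hb _) rfl).le, ?_⟩
    have := add_le_iterate hR k n
    omega
  have hbdd : ∃ N : ℕ, ∀ n, (∃ k, (recordMap x)^[n] k ∈ foil x i) → n ≤ N := by
    obtain ⟨u, hu⟩ := hfin.bddAbove
    obtain ⟨l, hl⟩ := hD.bddBelow
    refine ⟨(u - l).toNat, fun n ⟨k, hk⟩ => ?_⟩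
    have h1 := add_le_iterate hR k n
    have h2 := hu hk
    have h3 := hl (hsub k n hk)
    omega
  classical
  obtain ⟨N, hN⟩ := hbdd
  let p : ℕ → Prop := fun n => ∃ k, (recordMap x)^[n] k ∈ foil x i
  have hp0 : p 0 := ⟨i, mem_foil_self x i⟩
  obtain ⟨k, hk⟩ : p (Nat.findGreatest p N) := Nat.findGreatest_spec (Nat.zero_le _) hp0
  set n := Nat.findGreatest p N
  have hmem : ∀ l ∈ foil x k, (recordMap x)^[n] l ∈ foil x i := fun l hl =>
    mem_foil_trans hk (iterate_mem_foil hl n)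
  have hfk : (foil x k).Finite := hD.subset fun l hl => hsub l n (hmem l hl)
  obtain ⟨m, hm, hmax⟩ := Set.exists_max_image (foil x k) id hfk ⟨k, mem_foil_self x k⟩
  refine ⟨m, ?_⟩
  rw [IsYoungest, foil_eq_of_mem hm]
  refine ⟨⟨hm, fun l hl => hmax l hl⟩, fun l hl c hc => ?_⟩
  have h1 : p (n + 1) := ⟨c, by rw [Function.iterate_succ_apply, hc]; exact hmem l hl⟩
  have h2 : n + 1 ≤ n := Nat.le_findGreatest (hN _ h1) h1
  omega

/-- A vertex `j` has at least `x (j - 1) + 1` children. -/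
theorem exists_children (hx : ∀ n, -1 ≤ x n) (hB : ∀ j, ∃ i < j, walk x j < walk x i) (j : ℤ)
    {l : ℕ} (hl : (l : ℤ) ≤ x (j - 1)) :
    ∃ i < j, recordMap x i = j ∧ walk x i = walk x (j - 1) + l := by
  -- Climbing backwards by higher vertices gains at least one level each time. The child sought is
  -- the last vertex before `j` at or above level `walk x (j - 1) + l`.
  have hex : ∃ i ≤ j - 1, walk x (j - 1) + l ≤ walk x i := by
    clear hl
    induction l with
    | zero => exact ⟨j - 1, le_rfl, by simp⟩
    | succ l ih =>
      obtain ⟨i, hi, hw⟩ := ih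
      obtain ⟨i', hi', hw'⟩ := hB i
      exact ⟨i', by omega, by push_cast; omega⟩
  obtain ⟨i, ⟨hi, hw⟩, hmax⟩ := Int.exists_greatest_of_bdd
    (P := fun i => i ≤ j - 1 ∧ walk x (j - 1) + l ≤ walk x i) ⟨j - 1, fun z hz => hz.1⟩ hex
  have hlt : ∀ k, i < k → k < j → walk x k < walk x (j - 1) + l := by
    intro k hik hkj
    by_contra! hc
    have := hmax k ⟨by omega, hc⟩
    omega
  -- The walk drops below the level right after `i`, and a drop is at most one, so `i` sits exactly
  -- on the level.
  have hwi : walk x i = walk x (j - 1) + l := by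
    rcases hi.eq_or_lt with rfl | hi'
    · refine le_antisymm ?_ hw
      omega
    · have h1 := hlt (i + 1) (by omega) (by omega)
      rw [walk_add_one] at h1
      have := hx i
      omega
  refine ⟨i, by omega, recordMap_eq_iff.2 (Or.inl ⟨by omega, ?_, ?_⟩), hwi⟩
  · have := walk_add_one x (j - 1)
    rw [sub_add_cancel] at this
    omega
  · intro k hik hkj
    rw [hwi]
    exact hlt k hik hkj

/-! ### The orthogonal map as the successor map of each foil -/

theorem orthogonalMap_eq_iff {x : ℤ → ℤ} {i j : ℤ} : orthogonalMap x i = j ↔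
    IsLeast {k | i < k ∧ k ∈ foil x i} j ∨ ({k | i < k ∧ k ∈ foil x i} = ∅ ∧ j = i) := by
  rw [orthogonalMap, ite_sInf_eq_iff fun k hk => hk.1]

theorem isLeast_orthogonalMap (hmax : ∀ i, ¬ ∃ m, IsGreatest (foil x i) m) (i : ℤ) :
    IsLeast {k | i < k ∧ k ∈ foil x i} (orthogonalMap x i) := by
  rcases orthogonalMap_eq_iff.1 (rfl : orthogonalMap x i = _) with h | ⟨h, -⟩
  · exact h
  · refine absurd ⟨i, mem_foil_self x i, fun k hk => ?_⟩ (hmax i)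
    by_contra! hc
    exact (h ▸ (⟨hc, hk⟩ : k ∈ {k | i < k ∧ k ∈ foil x i}) : k ∈ (∅ : Set ℤ))

theorem orthogonalMap_bijective (hmax : ∀ i, ¬ ∃ m, IsGreatest (foil x i) m)
    (hmin : ∀ i, ¬ ∃ m, IsLeast (foil x i) m) : Function.Bijective (orthogonalMap x) := by
  have hL := isLeast_orthogonalMap hmax
  constructor
  · have aux : ∀ {i j}, orthogonalMap x i = orthogonalMap x j → ¬ i < j := by
      intro i j h hij
      have hi := hL i
      have hj := (hL j).1
      rw [h] at hi
      have h1 := hi.2 ⟨hij, mem_foil_trans hi.1.2 (mem_foil_symm hj.2)⟩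
      have h2 := hj.1
      omega
    intro i j h
    have h1 := aux h
    have h2 := aux h.symm
    omega
  · intro j
    have hex : ∃ i, i ∈ foil x j ∧ i < j := by
      by_contra! hc
      exact hmin j ⟨j, mem_foil_self x j, fun k hk => hc k hk⟩
    obtain ⟨i, ⟨hi, hij⟩, hg⟩ := Int.exists_greatest_of_bdd
      (P := fun i => i ∈ foil x j ∧ i < j) ⟨j, fun z hz => hz.2.le⟩ hex
    refine ⟨i, orthogonalMap_eq_iff.2 (Or.inl ⟨⟨hij, mem_foil_symm hi⟩, ?_⟩)⟩
    rintro k ⟨hik, hk⟩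
    by_contra! hc
    have := hg k ⟨mem_foil_trans hi hk, hc⟩
    omega

end Deterministic

/-! ### Equivariance under shifts -/

/-- The sequence `x` seen from `k`. -/
def shift (k : ℤ) (x : ℤ → ℤ) : ℤ → ℤ := fun n => x (n + k)

theorem partialSum_shift (k : ℤ) (x : ℤ → ℤ) (a b : ℤ) :
    partialSum (shift k x) a b = partialSum x (a + k) (b + k) := by
  simp only [partialSum, shift]
  rw [← Finset.map_add_right_Ico, Finset.sum_map]
  rfl

theorem walk_shift (k : ℤ) (x : ℤ → ℤ) (n : ℤ) :
    walk (shift k x) n = walk x (n + k) - walk x k := by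
  rcases le_total 0 n with h | h
  · have := partialSum_eq_walk_sub x (a := k) (b := n + k) (by omega)
    rw [walk, partialSum_of_le _ h, partialSum_shift, zero_add, this, sub_zero]
  · have := partialSum_eq_walk_sub x (a := n + k) (b := k) (by omega)
    rw [walk, partialSum_of_le _ h, partialSum_shift, zero_add, this]
    ring

theorem recordMap_shift (k : ℤ) (x : ℤ → ℤ) (i : ℤ) :
    recordMap (shift k x) i + k = recordMap x (i + k) := by
  symm
  rw [recordMap_eq_iff]
  refine (recordMap_eq_iff.1 (rfl : recordMap (shift k x) i = _)).imp ?_ ?_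
  · rintro ⟨h1, h2, h3⟩
    rw [walk_shift, walk_shift] at h2
    refine ⟨by omega, by omega, fun l hl hl' => ?_⟩
    have := h3 (l - k) (by omega) (by omega)
    rw [walk_shift, walk_shift, sub_add_cancel] at this
    omega
  · rintro ⟨h1, h2⟩
    refine ⟨fun l hl => ?_, by omega⟩
    have := h1 (l - k) (by omega)
    rw [walk_shift, walk_shift, sub_add_cancel] at this
    omega

theorem iterate_recordMap_shift (k : ℤ) (x : ℤ → ℤ) (n : ℕ) (i : ℤ) :
    (recordMap (shift k x))^[n] i + k = (recordMap x)^[n] (i + k) := by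
  induction n generalizing i with
  | zero => rfl
  | succ n ih => rw [Function.iterate_succ_apply, ih, recordMap_shift, Function.iterate_succ_apply]

theorem mem_foil_shift (k : ℤ) (x : ℤ → ℤ) (i j : ℤ) :
    j ∈ foil (shift k x) i ↔ j + k ∈ foil x (i + k) := by
  refine exists_congr fun n => ?_
  rw [← iterate_recordMap_shift, ← iterate_recordMap_shift, add_left_inj]

theorem orthogonalMap_shift (k : ℤ) (x : ℤ → ℤ) (i : ℤ) :
    orthogonalMap (shift k x) i + k = orthogonalMap x (i + k) := by
  symm
  rw [orthogonalMap_eq_iff]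
  refine (orthogonalMap_eq_iff.1 (rfl : orthogonalMap (shift k x) i = _)).imp ?_ ?_
  · rintro ⟨⟨h1, h2⟩, h3⟩
    rw [mem_foil_shift] at h2
    refine ⟨⟨by omega, h2⟩, ?_⟩
    rintro l ⟨hl, hl'⟩
    have := h3 (show l - k ∈ {l | i < l ∧ l ∈ foil (shift k x) i} from
      ⟨by omega, by rw [mem_foil_shift, sub_add_cancel]; exact hl'⟩)
    omega
  · rintro ⟨h1, h2⟩
    refine ⟨?_, by omega⟩
    rw [Set.eq_empty_iff_forall_notMem] at h1 ⊢
    rintro l ⟨hl, hl'⟩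
    exact h1 (l - k) ⟨by omega, by rw [mem_foil_shift, sub_add_cancel]; exact hl'⟩

theorem isGreatest_foil_shift (k : ℤ) (x : ℤ → ℤ) (i j : ℤ) :
    IsGreatest (foil (shift k x) i) j ↔ IsGreatest (foil x (i + k)) (j + k) := by
  refine and_congr (mem_foil_shift k x i j) ⟨fun h a ha => ?_, fun h a ha => ?_⟩
  · have := h (a := a - k) (by rwa [mem_foil_shift, sub_add_cancel])
    omega
  · have := h ((mem_foil_shift k x i a).1 ha)
    omega

theorem isLeast_foil_shift (k : ℤ) (x : ℤ → ℤ) (i j : ℤ) :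
    IsLeast (foil (shift k x) i) j ↔ IsLeast (foil x (i + k)) (j + k) := by
  refine and_congr (mem_foil_shift k x i j) ⟨fun h a ha => ?_, fun h a ha => ?_⟩
  · have := h (a := a - k) (by rwa [mem_foil_shift, sub_add_cancel])
    omega
  · have := h ((mem_foil_shift k x i a).1 ha)
    omega

theorem isYoungest_shift (k : ℤ) (x : ℤ → ℤ) (i : ℤ) :
    IsYoungest (shift k x) i ↔ IsYoungest x (i + k) := by
  have e : Function.Surjective fun l : ℤ => l + k := fun l => ⟨l - k, by simp⟩
  refine and_congr (isGreatest_foil_shift k x i i) ?_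
  rw [iff_comm, e.forall]
  refine forall_congr' fun l => ?_
  rw [mem_foil_shift]
  refine imp_congr_right fun _ => ?_
  rw [e.forall]
  refine forall_congr' fun j => ?_
  rw [← recordMap_shift, ne_eq, ne_eq, add_left_inj]

/-! ### Measurability -/

section Measurability

theorem measurable_walk (n : ℤ) : Measurable fun x => walk x n := by
  unfold walk partialSum
  fun_prop

theorem measurableSet_forall_set {α ι : Type*} [MeasurableSpace α] [Countable ι] {p : ι → α → Prop}
    (h : ∀ i, MeasurableSet {a | p i a}) : MeasurableSet {a | ∀ i, p i a} := by
  rw [Set.ofPred_forall]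
  exact MeasurableSet.iInter h

theorem measurableSet_exists_set {α ι : Type*} [MeasurableSpace α] [Countable ι] {p : ι → α → Prop}
    (h : ∀ i, MeasurableSet {a | p i a}) : MeasurableSet {a | ∃ i, p i a} := by
  rw [Set.ofPred_exists]
  exact MeasurableSet.iUnion h

theorem measurableSet_imp_set {α : Type*} [MeasurableSpace α] {p q : α → Prop}
    (h : MeasurableSet {a | p a}) (h' : MeasurableSet {a | q a}) :
    MeasurableSet {a | p a → q a} := by
  have : {a | p a → q a} = {a | p a}ᶜ ∪ {a | q a} := by
    ext a; simp [imp_iff_not_or]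
  rw [this]
  exact h.compl.union h'

theorem measurable_recordMap (i : ℤ) : Measurable fun x => recordMap x i := by
  refine measurable_to_countable' fun j => ?_
  have hw := measurable_walk
  have : (fun x => recordMap x i) ⁻¹' {j} =
      {x | (i < j ∧ walk x i ≤ walk x j ∧ ∀ k, i < k → k < j → walk x k < walk x i) ∨
        ((∀ k, i < k → walk x k < walk x i) ∧ j = i)} := by
    ext x
    exact recordMap_eq_iff
  rw [this]
  refine MeasurableSet.union (MeasurableSet.inter (MeasurableSet.const _) (MeasurableSet.inter
    (measurableSet_le (hw _) (hw _)) ?_)) (MeasurableSet.inter ?_ (MeasurableSet.const _))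
  · exact measurableSet_forall_set fun k => measurableSet_imp_set (.const _) <|
      measurableSet_imp_set (.const _) (measurableSet_lt (hw _) (hw _))
  · exact measurableSet_forall_set fun k => measurableSet_imp_set (.const _) <|
      measurableSet_lt (hw _) (hw _)

theorem measurable_apply_of_countable {α β ι : Type*} [MeasurableSpace α] [MeasurableSpace β]
    [MeasurableSpace ι] [Countable ι] [MeasurableSingletonClass ι] {F : α → ι → β} {g : α → ι}
    (hF : ∀ i, Measurable fun a => F a i) (hg : Measurable g) : Measurable fun a => F a (g a) :=
  (measurable_from_prod_countable_left (f := Function.uncurry F) hF).comp (measurable_id.prodMk hg)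

theorem measurable_iterate_recordMap (n : ℕ) (i : ℤ) :
    Measurable fun x => (recordMap x)^[n] i := by
  induction n generalizing i with
  | zero => exact measurable_const
  | succ n ih =>
    simp only [Function.iterate_succ_apply]
    exact measurable_apply_of_countable (F := fun x j => (recordMap x)^[n] j) ih
      (measurable_recordMap i)

theorem measurableSet_mem_foil (i j : ℤ) : MeasurableSet {x | j ∈ foil x i} :=
  measurableSet_exists_set fun n =>
    measurableSet_eq_fun (measurable_iterate_recordMap n i) (measurable_iterate_recordMap n j)

theorem measurableSet_isGreatest_foil (i j : ℤ) : MeasurableSet {x | IsGreatest (foil x i) j} :=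
  (measurableSet_mem_foil i j).inter <| measurableSet_forall_set fun k =>
    measurableSet_imp_set (measurableSet_mem_foil i k) (.const _)

theorem measurableSet_isLeast_foil (i j : ℤ) : MeasurableSet {x | IsLeast (foil x i) j} :=
  (measurableSet_mem_foil i j).inter <| measurableSet_forall_set fun k =>
    measurableSet_imp_set (measurableSet_mem_foil i k) (.const _)

theorem measurableSet_isYoungest (k : ℤ) : MeasurableSet {x | IsYoungest x k} :=
  (measurableSet_isGreatest_foil k k).inter <| measurableSet_forall_set fun l =>
    measurableSet_imp_set (measurableSet_mem_foil k l) <| measurableSet_forall_set fun i =>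
      (measurable_recordMap i (measurableSet_singleton l)).compl

theorem measurable_orthogonalMap (i : ℤ) : Measurable fun x => orthogonalMap x i := by
  refine measurable_to_countable' fun j => ?_
  have : (fun x => orthogonalMap x i) ⁻¹' {j} =
      {x | ((i < j ∧ j ∈ foil x i) ∧ ∀ k, i < k → k ∈ foil x i → j ≤ k) ∨
        ((∀ k, i < k → k ∉ foil x i) ∧ j = i)} := by
    ext x
    simp only [Set.mem_preimage, Set.mem_singleton_iff, orthogonalMap_eq_iff, IsLeast, lowerBounds,
      Set.eq_empty_iff_forall_notMem, Set.mem_ofPred_eq, not_and, and_imp]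
  rw [this]
  refine MeasurableSet.union (MeasurableSet.inter (MeasurableSet.inter (.const _)
    (measurableSet_mem_foil i j)) ?_) (MeasurableSet.inter ?_ (.const _))
  · exact measurableSet_forall_set fun k => measurableSet_imp_set (.const _) <|
      measurableSet_imp_set (measurableSet_mem_foil i k) (.const _)
  · exact measurableSet_forall_set fun k => measurableSet_imp_set (.const _) <|
      (measurableSet_mem_foil i k).compl

theorem measurable_shift (k : ℤ) : Measurable (shift k) := by
  unfold shift
  fun_prop

end Measurability

/-! ### Mass transport for stationary sequences -/

section MassTransport

variable {μ : Measure (ℤ → ℤ)}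

theorem measure_transport_eq (hμ : ∀ k, MeasurePreserving (shift k) μ μ)
    {T : (ℤ → ℤ) → ℤ → ℤ → Prop}
    (hT : ∀ i j, MeasurableSet {x | T x i j})
    (hTs : ∀ k x i j, T (shift k x) i j ↔ T x (i + k) (j + k)) (k i j : ℤ) :
    μ {x | T x i j} = μ {x | T x (i + k) (j + k)} := by
  rw [← (hμ k).measure_preimage (hT i j).nullMeasurableSet]
  simp only [Set.preimage_ofPred_eq, hTs]

/-- The mass transport principle: the expected mass sent equals the expected mass received. -/
theorem tsum_measure_transport (hμ : ∀ k, MeasurePreserving (shift k) μ μ)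
    {T : (ℤ → ℤ) → ℤ → ℤ → Prop}
    (hT : ∀ i j, MeasurableSet {x | T x i j})
    (hTs : ∀ k x i j, T (shift k x) i j ↔ T x (i + k) (j + k)) :
    ∑' i, μ {x | T x i 0} = ∑' j, μ {x | T x 0 j} := by
  -- Shifting by `j` turns the transport from `-j` to `0` into that from `0` to `j`.
  rw [← (Equiv.neg ℤ).tsum_eq]
  refine tsum_congr fun j => ?_
  rw [measure_transport_eq hμ hT hTs j]
  simp

theorem ae_forall_of_ae (hμ : ∀ k, MeasurePreserving (shift k) μ μ)
    {p : (ℤ → ℤ) → ℤ → Prop}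
    (hp : ∀ k x i, p (shift k x) i ↔ p x (i + k)) (h : ∀ᵐ x ∂μ, p x 0) :
    ∀ᵐ x ∂μ, ∀ i, p x i := by
  rw [ae_all_iff]
  intro i
  filter_upwards [(hμ i).quasiMeasurePreserving.ae h] with x hx
  rwa [hp, zero_add] at hx

/-- If every vertex sends mass to at most one vertex, then every vertex receives mass from finitely
many vertices. -/
theorem ae_finite_transport [IsProbabilityMeasure μ]
    (hμ : ∀ k, MeasurePreserving (shift k) μ μ) {T : (ℤ → ℤ) → ℤ → ℤ → Prop}
    (hT : ∀ i j, MeasurableSet {x | T x i j})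
    (hTs : ∀ k x i j, T (shift k x) i j ↔ T x (i + k) (j + k))
    (huniq : ∀ᵐ x ∂μ, ∀ j j', T x 0 j → T x 0 j' → j = j') :
    ∀ᵐ x ∂μ, ∀ j, {i | T x i j}.Finite := by
  refine ae_forall_of_ae hμ (p := fun x j => {i | T x i j}.Finite) ?_ ?_
  · intro k x j
    simp only [hTs]
    have : {i | T x (i + k) (j + k)} = (Equiv.addRight k) ⁻¹' {i | T x i (j + k)} := rfl
    rw [this]
    exact ⟨fun h => h.of_preimage (Equiv.surjective _), fun h => h.preimage (Equiv.injective _).injOn⟩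
  -- The mass sent is a sum over almost surely disjoint events, so the expected number of senders to
  -- `0` is at most one; Borel–Cantelli makes it finite.
  · have hle : ∑' i, μ {x | T x i 0} ≤ 1 := by
      rw [tsum_measure_transport hμ hT hTs]
      rw [← measure_iUnion₀ _ fun j => (hT 0 j).nullMeasurableSet]
      · exact prob_le_one
      · intro j j' hjj'
        rw [Function.onFun, AEDisjoint]
        refine measure_mono_null ?_ huniq
        intro x hx h
        exact hjj' (h j j' hx.1 hx.2)
    exact ae_finite_setOfPred_mem (hle.trans_lt ENNReal.one_lt_top).ne

end MassTransport

/-! ### A walk with steps at most one and mean zero becomes positive -/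

section Hitting

open Filter Topology

/-- The partial sums of `y`, stopped when they become positive. -/
noncomputable def stoppedSum (y : ℕ → ℝ) : ℕ → ℝ
  | 0 => 0
  | n + 1 => stoppedSum y n + (if stoppedSum y n ≤ 0 then 1 else 0) * y n

theorem stoppedSum_le_one {y : ℕ → ℝ} (hy : ∀ n, y n ≤ 1) (n : ℕ) : stoppedSum y n ≤ 1 := by
  induction n with
  | zero => simp [stoppedSum]
  | succ n ih =>
    rw [stoppedSum]
    split_ifs with h
    · linarith [hy n]
    · linarith

theorem stoppedSum_eq_sum {y : ℕ → ℝ} (hy : ∀ n, ∑ k ∈ Finset.range n, y k ≤ 0) (n : ℕ) :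
    stoppedSum y n = ∑ k ∈ Finset.range n, y k := by
  induction n with
  | zero => rfl
  | succ n ih => rw [stoppedSum, ih, if_pos (hy n), one_mul, Finset.sum_range_succ]

theorem stronglyMeasurable_stoppedSum {Ω : Type*} {m : MeasurableSpace Ω} {Y : ℕ → Ω → ℝ} {n : ℕ}
    (hY : ∀ k < n, StronglyMeasurable[m] (Y k)) :
    StronglyMeasurable[m] fun ω => stoppedSum (fun k => Y k ω) n := by
  induction n with
  | zero => exact stronglyMeasurable_const
  | succ n ih =>
    have h := ih fun k hk => hY k (by omega)
    refine h.add (StronglyMeasurable.mul ?_ (hY n (by omega)))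
    exact StronglyMeasurable.ite (h.measurable measurableSet_Iic) stronglyMeasurable_const
      stronglyMeasurable_const

variable {Ω : Type*} [MeasurableSpace Ω] {μ : Measure Ω} {Y : ℕ → Ω → ℝ}

theorem integrable_ite_mul {p : Ω → Prop} [DecidablePred p] (hp : MeasurableSet {ω | p ω})
    {f : Ω → ℝ} (hf : Integrable f μ) :
    Integrable (fun ω => (if p ω then 1 else 0) * f ω) μ := by
  have : (fun ω => (if p ω then 1 else 0) * f ω) = {ω | p ω}.indicator f := by
    ext ω
    by_cases h : p ω <;> simp [h]
  rw [this]
  exact hf.indicator hp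

/-- The stopped sums form a martingale bounded above by $1$, hence bounded in $L^1$ and convergent.
Without stopping they would be the partial sums themselves, whose steps infinitely often have size
at least $1$. -/
theorem ae_exists_sum_pos (hYm : ∀ n, Measurable (Y n)) (hind : iIndepFun Y μ)
    (hle : ∀ n, ∀ᵐ ω ∂μ, Y n ω ≤ 1) (hint : ∀ n, Integrable (Y n) μ)
    (hmean : ∀ n, ∫ ω, Y n ω ∂μ = 0) (hfreq : ∀ᵐ ω ∂μ, ∃ᶠ n in atTop, 1 ≤ |Y n ω|) :
    ∀ᵐ ω ∂μ, ∃ n, 0 < ∑ k ∈ Finset.range n, Y k ω := by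
  have := hind.isProbabilityMeasure
  have hYs : ∀ n, StronglyMeasurable (Y n) := fun n => (hYm n).stronglyMeasurable
  let ℱ := Filtration.natural Y hYs
  let M : ℕ → Ω → ℝ := fun n ω => stoppedSum (fun k => Y k ω) n
  -- `ℱ n` already knows `Y n`, so the martingale is indexed by `M (n + 1)`.
  have hMF : ∀ n, StronglyMeasurable[ℱ n] (M (n + 1)) := fun n =>
    stronglyMeasurable_stoppedSum fun k hk =>
      (Filtration.stronglyAdapted_natural hYs k).mono (ℱ.mono (by omega))
  have hMm : ∀ n, Measurable (M n) := fun n =>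
    (stronglyMeasurable_stoppedSum fun k _ => hYs k).measurable
  have hstep : ∀ n, Integrable (fun ω => (if M n ω ≤ 0 then 1 else 0) * Y n ω) μ := fun n =>
    integrable_ite_mul (hMm n measurableSet_Iic) (hint n)
  have hMint : ∀ n, Integrable (M n) μ := by
    intro n
    induction n with
    | zero => exact integrable_const 0
    | succ n ih => exact ih.add (hstep n)
  have hcond : ∀ n, M (n + 1) =ᵐ[μ] μ[M (n + 1 + 1) | ℱ n] := by
    intro n
    let g : Ω → ℝ := fun ω => if M (n + 1) ω ≤ 0 then 1 else 0
    have hg : StronglyMeasurable[ℱ n] g :=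
      StronglyMeasurable.ite ((hMF n).measurable measurableSet_Iic) stronglyMeasurable_const
        stronglyMeasurable_const
    have h1 : M (n + 1 + 1) = M (n + 1) + g * Y (n + 1) := rfl
    have h2 := condExp_add (hMint (n + 1)) (hstep (n + 1)) (ℱ n)
    have h3 := condExp_mul_of_stronglyMeasurable_left hg (hstep (n + 1)) (hint (n + 1))
    have h4 := hind.condExp_natural_ae_eq_of_lt hYs (Nat.lt_succ_self n)
    have h5 := condExp_of_stronglyMeasurable (ℱ.le n) (hMF n) (hMint (n + 1))
    rw [h1]
    filter_upwards [h2, h3, h4] with ω h2 h3 h4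
    refine Eq.trans ?_ h2.symm
    rw [Pi.add_apply, h5]
    refine Eq.trans ?_ (congrArg _ h3.symm)
    rw [Pi.mul_apply]
    have h4' : (μ[Y (n + 1) | ℱ n]) ω = 0 := h4.trans (hmean (n + 1))
    rw [h4', mul_zero, add_zero]
  have hmart : Martingale (fun n => M (n + 1)) ℱ μ :=
    martingale_nat hMF (fun n => hMint (n + 1)) hcond
  have hzero : ∀ n, ∫ ω, M (n + 1) ω ∂μ = 0 := by
    intro n
    induction n with
    | zero =>
      rw [← hmean 0]
      exact integral_congr_ae (ae_of_all _ fun ω => by simp [M, stoppedSum])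
    | succ n ih =>
      rw [← integral_condExp (ℱ.le n), ← ih]
      exact (integral_congr_ae (hcond n)).symm
  have hle' : ∀ᵐ ω ∂μ, ∀ n, Y n ω ≤ 1 := ae_all_iff.2 hle
  have hbdd : ∀ n, eLpNorm (M (n + 1)) 1 μ ≤ (2 : NNReal) := by
    intro n
    rw [eLpNorm_one_eq_lintegral_enorm, ← ofReal_integral_norm_eq_lintegral_enorm (hMint _)]
    -- $|m|\le 2-m$ holds for every $m\le 1$, and $M$ has mean zero.
    have : ∫ ω, ‖M (n + 1) ω‖ ∂μ ≤ ∫ ω, (2 - M (n + 1) ω) ∂μ := by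
      refine integral_mono_ae (hMint _).norm ((integrable_const _).sub (hMint _)) ?_
      filter_upwards [hle'] with ω hω
      have := stoppedSum_le_one hω (n + 1)
      change |M (n + 1) ω| ≤ 2 - M (n + 1) ω
      have h' : M (n + 1) ω ≤ 1 := this
      rw [abs_le]
      constructor <;> linarith
    rw [integral_sub (integrable_const _) (hMint _), hzero, integral_const, probReal_univ] at this
    refine (ENNReal.ofReal_le_ofReal this).trans ?_
    simp
  have hconv := hmart.submartingale.exists_ae_tendsto_of_bdd hbdd
  filter_upwards [hconv, hfreq] with ω ⟨c, hc⟩ hω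
  by_contra! hcon
  have hM : ∀ n, M n ω = ∑ k ∈ Finset.range n, Y k ω := stoppedSum_eq_sum hcon
  have hc' : Tendsto (fun n => M n ω) atTop (𝓝 c) := (tendsto_add_atTop_iff_nat 1).1 hc
  have hY0 : Tendsto (fun n => Y n ω) atTop (𝓝 0) := by
    have := hc.sub hc'
    rw [sub_self] at this
    refine this.congr fun n => ?_
    rw [hM, hM, Finset.sum_range_succ, add_sub_cancel_left]
  have h1 : ∀ᶠ n in atTop, |Y n ω| < 1 := by
    have := hY0.abs
    rw [abs_zero] at this
    exact this.eventually_lt_const one_pos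
  obtain ⟨n, hn, hn'⟩ := (hω.and_eventually h1).exists
  linarith

end Hitting

/-! ### Records of a centred skip-free walk -/

section Law

open Filter

variable {ν : Measure ℤ} [IsProbabilityMeasure ν]

theorem measurePreserving_shift (k : ℤ) :
    MeasurePreserving (shift k) (Measure.infinitePi fun _ : ℤ => ν)
      (Measure.infinitePi fun _ : ℤ => ν) :=
  ⟨measurable_shift k, Measure.map_infinitePi_infinitePi_of_inj (P := fun _ : ℤ => ν)
    (f := fun n : ℤ => n + k) (add_left_injective k)⟩

theorem ae_forall_apply {p : ℤ → Prop} (h : ∀ᵐ n ∂ν, p n) :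
    ∀ᵐ x ∂(Measure.infinitePi fun _ : ℤ => ν), ∀ n, p (x n) := by
  rw [ae_all_iff]
  exact fun n => (measurePreserving_eval_infinitePi (fun _ : ℤ => ν) n).quasiMeasurePreserving.ae h

/-- Second Borel–Cantelli lemma along distinct coordinates. -/
theorem ae_frequently_apply_eq {a : ℤ} (ha : ν {a} ≠ 0) {f : ℕ → ℤ} (hf : Function.Injective f) :
    ∀ᵐ x ∂(Measure.infinitePi fun _ : ℤ => ν), ∃ᶠ n in atTop, x (f n) = a := by
  set μ := Measure.infinitePi fun _ : ℤ => ν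
  have hind : iIndepFun (fun (n : ℕ) (x : ℤ → ℤ) => x (f n)) μ :=
    .precomp hf <| iIndepFun_infinitePi (X := fun _ m => m) fun _ => measurable_id
  have hm : ∀ n, MeasurableSet {x : ℤ → ℤ | x (f n) = a} := fun n =>
    measurableSet_eq_fun (measurable_pi_apply (f n)) measurable_const
  have hset : iIndepSet (fun n => {x : ℤ → ℤ | x (f n) = a}) μ := by
    rw [iIndepSet_iff_meas_biInter hm]
    intro s
    exact hind.measure_inter_preimage_eq_mul s fun _ _ => measurableSet_singleton a
  have hval : ∀ n, μ {x : ℤ → ℤ | x (f n) = a} = ν {a} := fun n =>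
    (measurePreserving_eval_infinitePi (fun _ : ℤ => ν) (f n)).measure_preimage
      (measurableSet_singleton a).nullMeasurableSet
  have hsum : ∑' n, μ {x : ℤ → ℤ | x (f n) = a} = ⊤ := by
    simp only [hval]
    exact ENNReal.tsum_const_eq_top_of_ne_zero ha
  have h1 := measure_limsup_eq_one hm hset hsum
  have h2 := (mem_ae_iff_prob_eq_one (MeasurableSet.measurableSet_limsup hm)).2 h1
  filter_upwards [h2] with x hx
  exact mem_limsup_iff_frequently_mem (s := fun n => {x : ℤ → ℤ | x (f n) = a}).1 hx

theorem ae_exists_walk_lt (hge : ∀ᵐ n ∂ν, -1 ≤ n) (hpos : ν {-1} ≠ 0)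
    (hint : Integrable (fun n : ℤ => (n : ℝ)) ν) (hmean : ∫ n, (n : ℝ) ∂ν = 0) :
    ∀ᵐ x ∂(Measure.infinitePi fun _ : ℤ => ν), ∀ j, ∃ i < j, walk x j < walk x i := by
  refine ae_forall_of_ae measurePreserving_shift (p := fun x j => ∃ i < j, walk x j < walk x i)
    ?_ ?_
  · intro k x j
    simp only [walk_shift]
    constructor
    · rintro ⟨i, hi, h⟩
      exact ⟨i + k, by omega, by omega⟩
    · rintro ⟨i, hi, h⟩
      exact ⟨i - k, by omega, by rw [sub_add_cancel]; omega⟩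
  · set μ := Measure.infinitePi fun _ : ℤ => ν
    let f : ℕ → ℤ := fun n => -1 - n
    have hf : Function.Injective f := fun a b h => by simp only [f] at h; omega
    have hmp := fun n => measurePreserving_eval_infinitePi (fun _ : ℤ => ν) n
    have hcast : Measurable fun n : ℤ => (-n : ℝ) := measurable_from_top
    -- Reading backwards from `0` with the sign reversed gives steps at most one, with partial sums
    -- $S_{-n}-S_0$.
    have key := ae_exists_sum_pos (μ := μ) (Y := fun n x => (-(x (f n)) : ℝ))
      (fun n => hcast.comp (measurable_pi_apply (f n)))
      (.precomp hf <| iIndepFun_infinitePi (X := fun _ (m : ℤ) => (-m : ℝ)) fun _ => hcast)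
      (fun n => by
        filter_upwards [ae_forall_apply hge] with x hx
        have h : ((-1 : ℤ) : ℝ) ≤ x (f n) := Int.cast_le.2 (hx (f n))
        push_cast at h
        linarith)
      (fun n => (hmp (f n)).integrable_comp_of_integrable hint.neg)
      (fun n => by
        have h := integral_map (μ := μ) (φ := Function.eval (f n)) (hmp (f n)).aemeasurable
          (f := fun m : ℤ => (-m : ℝ)) hcast.aestronglyMeasurable
        rw [(hmp (f n)).map_eq, integral_neg, hmean, neg_zero] at h
        exact h.symm)
      (by
        filter_upwards [ae_frequently_apply_eq hpos hf] with x hx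
        refine hx.mono fun n hn => ?_
        rw [hn]
        norm_num)
    filter_upwards [key] with x ⟨n, hn⟩
    have hsum : ∀ n : ℕ, ∑ k ∈ Finset.range n, (-(x (f k)) : ℝ) =
        ((walk x (-n) - walk x 0 : ℤ) : ℝ) := by
      intro n
      induction n with
      | zero => simp
      | succ n ih =>
        rw [Finset.sum_range_succ, ih]
        have h := walk_add_one x (f n)
        rw [show f n + 1 = -(n : ℤ) by simp only [f]; ring] at h
        rw [h, show f n = -((n + 1 : ℕ) : ℤ) by simp only [f]; push_cast; ring]
        push_cast
        ring
    rw [hsum, Int.cast_pos] at hn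
    refine ⟨-n, ?_, by omega⟩
    rcases n with _ | n
    · simp at hn
    · omega

/-- The mass received at $0$ is its number of children, at least $x_{-1}+1$ and so of mean at least
$1$; the mass sent is the indicator of $R(0)>0$. -/
theorem ae_lt_recordMap (hge : ∀ᵐ n ∂ν, -1 ≤ n) (hpos : ν {-1} ≠ 0)
    (hint : Integrable (fun n : ℤ => (n : ℝ)) ν) (hmean : ∫ n, (n : ℝ) ∂ν = 0) :
    ∀ᵐ x ∂(Measure.infinitePi fun _ : ℤ => ν), ∀ i, i < recordMap x i := by
  have hB := ae_exists_walk_lt hge hpos hint hmean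
  have hge' := ae_forall_apply hge
  have hmp := measurePreserving_eval_infinitePi (fun _ : ℤ => ν) (-1)
  set μ := Measure.infinitePi fun _ : ℤ => ν
  refine ae_forall_of_ae measurePreserving_shift (p := fun x i => i < recordMap x i) ?_ ?_
  · intro k x i
    rw [← recordMap_shift]
    omega
  · have hT : ∀ i j, MeasurableSet {x | recordMap x i = j ∧ i < j} := fun i j =>
      (measurable_recordMap i (measurableSet_singleton j)).inter (.const _)
    have hmtp := tsum_measure_transport (μ := μ) measurePreserving_shift
      (T := fun x i j => recordMap x i = j ∧ i < j) hT fun k x i j => by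
        rw [← recordMap_shift]; omega
    have hout : ∑' j, μ {x | recordMap x 0 = j ∧ 0 < j} = μ {x | 0 < recordMap x 0} := by
      rw [← measure_iUnion _ fun j => hT 0 j]
      · congr 1
        ext x
        simp
      · intro j j' hjj'
        refine Set.disjoint_left.2 fun x hx hx' => hjj' ?_
        exact hx.1.symm.trans hx'.1
    have hin : 1 ≤ ∑' i, μ {x | recordMap x i = 0 ∧ i < 0} := by
      calc (1 : ENNReal) = ENNReal.ofReal (∫ n, ((n : ℝ) + 1) ∂ν) := by
            rw [integral_add hint (integrable_const 1), hmean]; simp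
        _ = ∫⁻ n, ENNReal.ofReal ((n : ℝ) + 1) ∂ν := by
            refine ofReal_integral_eq_lintegral_ofReal (hint.add (integrable_const 1)) ?_
            filter_upwards [hge] with n hn
            have h : ((-1 : ℤ) : ℝ) ≤ n := Int.cast_le.2 hn
            push_cast at h
            change (0 : ℝ) ≤ n + 1
            linarith
        _ = ∫⁻ x, ENNReal.ofReal ((x (-1) : ℝ) + 1) ∂μ :=
            (hmp.lintegral_comp (f := fun n : ℤ => ENNReal.ofReal ((n : ℝ) + 1))
              measurable_from_top).symm
        _ ≤ ∫⁻ x, ∑' i, {x | recordMap x i = 0 ∧ i < 0}.indicator 1 x ∂μ := by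
            refine lintegral_mono_ae ?_
            filter_upwards [hB, hge'] with x hB hx
            obtain ⟨N, hN⟩ : ∃ N : ℕ, (N : ℤ) = x (-1) + 1 :=
              ⟨(x (-1) + 1).toNat, Int.toNat_of_nonneg (by have := hx (-1); omega)⟩
            have hch := fun l : Fin N => exists_children hx hB 0 (l := l) (by
              have := l.2
              rw [zero_sub]
              omega)
            choose c hc hRc hwc using hch
            have hinj : Function.Injective c := by
              intro l l' h
              have h1 := hwc l
              rw [h, hwc l'] at h1
              exact Fin.ext (by omega)
            have h1 : ((x (-1) : ℝ) + 1) = (N : ℝ) := by exact_mod_cast hN.symm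
            rw [h1, ENNReal.ofReal_natCast]
            refine le_trans ?_ (ENNReal.sum_le_tsum (Finset.univ.map ⟨c, hinj⟩))
            rw [Finset.sum_map]
            have h2 : ∀ l : Fin N, {x | recordMap x (c l) = 0 ∧ c l < 0}.indicator
                (1 : (ℤ → ℤ) → ENNReal) x = 1 := fun l =>
              Set.indicator_of_mem (show x ∈ {x | recordMap x (c l) = 0 ∧ c l < 0} from
                ⟨hRc l, hc l⟩) _
            simp [h2]
        _ = ∑' i, μ {x | recordMap x i = 0 ∧ i < 0} := by
            rw [lintegral_tsum fun i => (measurable_one.indicator (hT i 0)).aemeasurable]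
            exact tsum_congr fun i => lintegral_indicator_one (hT i 0)
    rw [hmtp, hout] at hin
    exact (mem_ae_iff_prob_eq_one (measurableSet_lt measurable_const (measurable_recordMap 0))).2
      (le_antisymm prob_le_one hin)

/-- If some foil were finite, every vertex would send its mass to the unique youngest vertex, which
would then receive from all of $\mathbb Z$. -/
theorem ae_infinite_foil (hge : ∀ᵐ n ∂ν, -1 ≤ n) (hpos : ν {-1} ≠ 0)
    (hint : Integrable (fun n : ℤ => (n : ℝ)) ν) (hmean : ∫ n, (n : ℝ) ∂ν = 0) :
    ∀ᵐ x ∂(Measure.infinitePi fun _ : ℤ => ν), ∀ i, (foil x i).Infinite := by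
  have hR := ae_lt_recordMap hge hpos hint hmean
  have hfin := ae_finite_transport (μ := Measure.infinitePi fun _ : ℤ => ν)
    measurePreserving_shift (T := fun x _ j => IsYoungest x j)
    (fun _ j => measurableSet_isYoungest j) (fun k x _ j => isYoungest_shift k x j)
    (by filter_upwards [hR] with x hx j j' hj hj' using hj.unique hx hj')
  filter_upwards [hR, ae_exists_walk_lt hge hpos hint hmean, hfin] with x hR hB hfin i hi
  obtain ⟨k, hk⟩ := exists_isYoungest hR hB hi
  have := hfin k
  simp only [hk, Set.ofPred_true] at this
  exact Set.infinite_univ this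

/-- Each vertex sends mass to the largest element of its foil; such an element would receive
infinitely many units. -/
theorem ae_no_greatest (hge : ∀ᵐ n ∂ν, -1 ≤ n) (hpos : ν {-1} ≠ 0)
    (hint : Integrable (fun n : ℤ => (n : ℝ)) ν) (hmean : ∫ n, (n : ℝ) ∂ν = 0) :
    ∀ᵐ x ∂(Measure.infinitePi fun _ : ℤ => ν), ∀ i, ¬ ∃ m, IsGreatest (foil x i) m := by
  have hfin := ae_finite_transport (μ := Measure.infinitePi fun _ : ℤ => ν)
    measurePreserving_shift (T := fun x i j => IsGreatest (foil x i) j)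
    measurableSet_isGreatest_foil isGreatest_foil_shift (ae_of_all _ fun x j j' h h' => h.unique h')
  filter_upwards [ae_infinite_foil hge hpos hint hmean, hfin] with x hinf hfin i ⟨m, hm⟩
  refine hinf i ((hfin m).subset fun j hj => ?_)
  rwa [Set.mem_ofPred_eq, foil_eq_of_mem hj]

theorem ae_no_least (hge : ∀ᵐ n ∂ν, -1 ≤ n) (hpos : ν {-1} ≠ 0)
    (hint : Integrable (fun n : ℤ => (n : ℝ)) ν) (hmean : ∫ n, (n : ℝ) ∂ν = 0) :
    ∀ᵐ x ∂(Measure.infinitePi fun _ : ℤ => ν), ∀ i, ¬ ∃ m, IsLeast (foil x i) m := by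
  have hfin := ae_finite_transport (μ := Measure.infinitePi fun _ : ℤ => ν)
    measurePreserving_shift (T := fun x i j => IsLeast (foil x i) j)
    measurableSet_isLeast_foil isLeast_foil_shift (ae_of_all _ fun x j j' h h' => h.unique h')
  filter_upwards [ae_infinite_foil hge hpos hint hmean, hfin] with x hinf hfin i ⟨m, hm⟩
  refine hinf i ((hfin m).subset fun j hj => ?_)
  rwa [Set.mem_ofPred_eq, foil_eq_of_mem hj]

/-! ### Re-rooting along the orthogonal map -/

theorem measurable_shift_orthogonalMap : Measurable fun x => shift (orthogonalMap x 0) x :=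
  measurable_apply_of_countable (F := fun x k => shift k x) measurable_shift
    (measurable_orthogonalMap 0)

/-- A stationary law is preserved by re-rooting at the image of `0` under the orthogonal map
if the latter is almost surely bijective. -/
theorem measurePreserving_shift_orthogonalMap {μ : Measure (ℤ → ℤ)}
    (hμ : ∀ k, MeasurePreserving (shift k) μ μ)
    (hbij : ∀ᵐ x ∂μ, Function.Bijective (orthogonalMap x)) :
    MeasurePreserving (fun x => shift (orthogonalMap x 0) x) μ μ := by
  refine ⟨measurable_shift_orthogonalMap, Measure.ext fun B hB => ?_⟩
  rw [Measure.map_apply measurable_shift_orthogonalMap hB]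
  have hT : ∀ i j, MeasurableSet {x | orthogonalMap x i = j ∧ shift j x ∈ B} := fun i j =>
    (measurable_orthogonalMap i (measurableSet_singleton j)).inter (measurable_shift j hB)
  -- Each vertex sends one unit to its image, provided the sequence seen from that image lies in
  -- `B`. Outgoing mass at `0` gives the re-rooted law; by bijectivity, incoming mass gives the
  -- original one.
  have hmtp := tsum_measure_transport hμ
    (T := fun x i j => orthogonalMap x i = j ∧ shift j x ∈ B) hT fun k x i j => by
      have h : shift j (shift k x) = shift (j + k) x := by
        ext n
        simp only [shift, add_assoc]
      rw [h, ← orthogonalMap_shift, add_left_inj]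
  rw [← measure_iUnion _ fun j => hT 0 j, ← measure_iUnion₀ _ fun j => (hT j 0).nullMeasurableSet]
    at hmtp
  · refine Eq.trans ?_ (hmtp.symm.trans (measure_congr ?_))
    · congr 1
      ext x
      simp
    · filter_upwards [hbij] with x hx
      obtain ⟨i, hi⟩ := hx.2 0
      have h0 : shift 0 x = x := by ext n; simp [shift]
      refine propext ⟨fun h => ?_, fun h => ?_⟩
      · obtain ⟨j, hj⟩ := Set.mem_iUnion.1 h
        have := hj.2
        rwa [h0] at this
      · exact Set.mem_iUnion.2 ⟨i, hi, by rwa [h0]⟩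
  · intro i j hij
    rw [Function.onFun, AEDisjoint]
    exact measure_mono_null (fun x hx (h : Function.Bijective (orthogonalMap x)) => hij (h.1 (hx.1.1.trans hx.2.1.symm))) hbij
  · intro j j' hjj'
    exact Set.disjoint_left.2 fun x hx hx' => hjj' (hx.1.symm.trans hx'.1)

end Law

/-! ### The network of a sequence as a random variable -/

section Network

theorem abs_sub_le_length {a b : ℤ} (p : lineGraph.Walk a b) : |b - a| ≤ p.length := by
  induction p with
  | nil => simp
  | cons h p ih =>
    rw [SimpleGraph.Walk.length_cons]
    rw [abs_le] at ih ⊢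
    push_cast
    rcases h with h | h <;> constructor <;> omega

/-- The translation $n\mapsto n-i$ is an isomorphism; it trades a random root for a random shift. -/
theorem network_eq_network_shift (i : ℤ) (x : ℤ → ℤ) : network i x = network 0 (shift i x) := by
  let φ : lineGraph ≃g lineGraph := ⟨Equiv.subRight i, by
    intro a b
    change (b - i = a - i + 1 ∨ a - i = b - i + 1) ↔ (b = a + 1 ∨ a = b + 1)
    omega⟩
  have h : (seqNetwork i x).Equivalent (seqNetwork 0 (shift i x)) := by
    refine ⟨φ, sub_self i, fun _ => rfl, fun (u v : ℤ) _ => ?_⟩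
    change (if v - i = u - i + 1 then (x (u - i + i), false) else (x (v - i + i), true)) =
      if v = u + 1 then (x u, false) else (x v, true)
    rw [sub_add_cancel, sub_add_cancel]
    exact if_congr (by omega) rfl rfl
  exact Quotient.sound h

theorem seqNetwork_edgeMark_congr {i : ℤ} {x y : ℤ → ℤ} {u v : ℤ} (hu : x u = y u)
    (hv : x v = y v) : (seqNetwork i x).edgeMark u v = (seqNetwork i y).edgeMark u v := by
  change (if v = u + 1 then (x u, false) else (x v, true)) =
    if v = u + 1 then (y u, false) else (y v, true)
  rw [hu, hv]

/-- The ball of radius $r$ around the root reads only the increments with index in $[-r,r]$, so each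
generating open set pulls back to a union of cylinders. -/
theorem continuous_network : Continuous (network 0) := by
  refine continuous_generateFrom_iff.2 ?_
  rintro _ ⟨r, N, rfl⟩
  refine isOpen_iff_forall_mem_open.2 ?_
  rintro x ⟨M, hM, φ, hφr, hφv, hφe⟩
  obtain ⟨ψ, hψr, hψv, hψe⟩ : M.Equivalent (seqNetwork 0 x) := Quotient.exact hM.symm
  have hball : ∀ u ∈ M.ball r, ψ u ∈ Set.Icc (-r : ℤ) r := by
    intro u hu
    obtain ⟨p, hp⟩ := M.connected.exists_walk_length_eq_dist M.root u
    let f : M.graph →g lineGraph := ψ.toHom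
    have h1 := abs_sub_le_length (p.map f)
    have h2 : f M.root = (0 : ℤ) := hψr
    rw [SimpleGraph.Walk.length_map, hp, h2, sub_zero] at h1
    have h3 : ((M.graph.dist M.root u : ℕ) : ℤ) ≤ r := Int.ofNat_le.2 hu
    exact abs_le.1 (h1.trans h3)
  refine ⟨(Set.Icc (-r : ℤ) r).pi fun u => {x u}, fun y hy => ?_,
    isOpen_set_pi (Set.finite_Icc _ _) fun _ _ => isOpen_discrete _, fun _ _ => rfl⟩
  -- The witness `M` with its edge marks reread from `y` through `ψ` represents the network of `y`.
  -- On the ball the marks are unchanged, so `φ` still works.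
  let M' : RootedNetwork (ℤ × Bool) :=
    { M with edgeMark := fun u v => (seqNetwork 0 y).edgeMark (ψ u) (ψ v) }
  refine ⟨M', ?_, φ, hφr, hφv, fun u v huv => ?_⟩
  · have h : M'.Equivalent (seqNetwork 0 y) := ⟨ψ, hψr, hψv, fun _ _ _ => rfl⟩
    exact (Quotient.sound h).symm
  · rw [← hφe u v huv]
    have hadj : M.graph.Adj (φ u) (φ v) := φ.map_adj_iff.2 huv
    rw [← hψe _ _ hadj]
    exact seqNetwork_edgeMark_congr (hy _ (hball _ (φ u).2)) (hy _ (hball _ (φ v).2))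

end Network

/-! ### Transfer from the product measure to the given random variables -/

theorem IsSkipFreeIncrements.measurePreserving {Ω : Type*} [MeasurableSpace Ω] {P : Measure Ω}
    [IsProbabilityMeasure P] {X : ℤ → Ω → ℤ} (hX : IsSkipFreeIncrements P X) :
    MeasurePreserving (fun ω n => X n ω) P (Measure.infinitePi fun _ : ℤ => P.map (X 0)) := by
  refine ⟨measurable_pi_iff.2 hX.measurable, ?_⟩
  rw [hX.indep.map_fun_eq_infinitePi_map hX.measurable]
  congr 1
  exact funext fun n => (hX.identDistrib n).map_eq

end RecordFoil

theorem mainTheorem5 {Ω : Type*} [MeasurableSpace Ω] (P : Measure Ω) [IsProbabilityMeasure P]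
    (X : ℤ → Ω → ℤ) (hX : RecordFoil.IsSkipFreeIncrements P X)
    (hmean : ∫ ω, (X 0 ω : ℝ) ∂P = 0) :
    -- almost surely, no foil has a largest element, and the orthogonal map is bijective
    (∀ᵐ ω ∂P, ∀ i : ℤ, ¬ ∃ m, IsGreatest (RecordFoil.foil (fun n => X n ω) i) m) ∧
    (∀ᵐ ω ∂P, Function.Bijective (RecordFoil.orthogonalMap (fun n => X n ω))) ∧
    -- the network re-rooted at the image of `0` has the same law as the original one
    IdentDistrib
      (fun ω => RecordFoil.network (RecordFoil.orthogonalMap (fun n => X n ω) 0) (fun n => X n ω))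
      (fun ω => RecordFoil.network 0 (fun n => X n ω)) P P ∧
    -- equivalently, the sequence seen from the image of `0` has the same law as the sequence
    IdentDistrib
      (fun ω n => X (n + RecordFoil.orthogonalMap (fun n => X n ω) 0) ω)
      (fun ω n => X n ω) P P := by
  have hm : AEMeasurable (X 0) P := (hX.measurable 0).aemeasurable
  have : IsProbabilityMeasure (P.map (X 0)) := Measure.isProbabilityMeasure_map hm
  have hcast : AEStronglyMeasurable (fun n : ℤ => (n : ℝ)) (P.map (X 0)) :=
    (measurable_from_top : Measurable fun n : ℤ => (n : ℝ)).aestronglyMeasurable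
  have hge : ∀ᵐ n ∂P.map (X 0), -1 ≤ n :=
    (ae_map_iff hm (MeasurableSet.of_discrete : MeasurableSet {n : ℤ | -1 ≤ n})).2 (hX.neg_one_le 0)
  have hpos : P.map (X 0) {-1} ≠ 0 := by
    rw [Measure.map_apply (hX.measurable 0) (measurableSet_singleton _)]
    exact hX.neg_one_pos.ne'
  have hint : Integrable (fun n : ℤ => (n : ℝ)) (P.map (X 0)) :=
    (integrable_map_measure hcast hm).2 hX.integrable
  have hzero : ∫ n, (n : ℝ) ∂P.map (X 0) = 0 := (integral_map hm hcast).trans hmean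
  have hΦ := hX.measurePreserving
  have hgreatest := RecordFoil.ae_no_greatest hge hpos hint hzero
  have hbij : ∀ᵐ x ∂(Measure.infinitePi fun _ : ℤ => P.map (X 0)),
      Function.Bijective (RecordFoil.orthogonalMap x) := by
    filter_upwards [hgreatest, RecordFoil.ae_no_least hge hpos hint hzero] with x hx hx'
      using RecordFoil.orthogonalMap_bijective hx hx'
  have hcomp := (RecordFoil.measurePreserving_shift_orthogonalMap
    RecordFoil.measurePreserving_shift hbij).comp hΦ
  have hseq : IdentDistrib
      (fun ω n => X (n + RecordFoil.orthogonalMap (fun n => X n ω) 0) ω)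
      (fun ω n => X n ω) P P :=
    ⟨hcomp.aemeasurable, hΦ.aemeasurable, hcomp.map_eq.trans hΦ.map_eq.symm⟩
  refine ⟨hΦ.quasiMeasurePreserving.ae hgreatest, hΦ.quasiMeasurePreserving.ae hbij, ?_, hseq⟩
  simp only [fun ω => RecordFoil.network_eq_network_shift
    (RecordFoil.orthogonalMap (fun n => X n ω) 0) fun n => X n ω]
  exact hseq.comp RecordFoil.continuous_network.measurable
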